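/- All spaces are topological spaces; Polish spaces and metrizable compacta may be empty. Two classes of spaces are \emph{equivalent} if every space in either class is homeomorphic to a space in the other. A class $\mathcal{C}$ is \emph{compactifiable} (resp. \emph{Polishable}) if there is a continuous map $q\colon A\to B$ between metrizable compacta (resp. Polish spaces) such that the family of fibers $\{q^{-1}(b): b\in B\}$ is equivalent to $\mathcal{C}$. For a class $\mathcal{F}$ of continuous maps let $\mathrm{Obj}(\mathcal{F})$ be the class of all domains and codomains of maps from $\mathcal{F}$. A space is \emph{$\mathcal{F}$-like} if it is homeomorphic to the limit $\{(x_n)_n\in\prod_n X_n : x_n=f_n(x_{n+1}) \text{ for all } n\}$ of an inverse sequence $X_0\xleftarrow{f_0}X_1\xleftarrow{f_1}\cdots$ with all bonding maps $f_n$ in $\mathcal{F}$. For a class $\mathcal{P}$ of spaces, a space is \emph{$\mathcal{P}$-like} if it is $\mathcal{F}$-like for $\mathcal{F}$ the class of all continuous surjections between spaces from $\mathcal{P}$; \emph{circle-like} means $\{S^1\}$-like. \textbf{Theorem.} Let $\mathcal{F}$ be a family of continuous maps. \begin{enumerate} \item If $\mathcal{F}$ is countable and every space in $\mathrm{Obj}(\mathcal{F})$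 is Polish, then the class of all $\mathcal{F}$-like spaces is Polishable. \item If $\mathrm{Obj}(\mathcal{F})$ is a countable family of metrizable compacta and every $X\in\mathrm{Obj}(\mathcal{F})$ is $\mathcal{F}$-like, then the class of all $\mathcal{F}$-like spaces is compactifiable. (A space $X$ is $\mathcal{F}$-like in particular if $\mathrm{id}_X\in\mathcal{F}$.) \end{enumerate} Consequently, for every countable family $\mathcal{P}$ of metrizable compacta, the class of all $\mathcal{P}$-like spaces is compactifiable. In particular, the class of all circle-like spaces is compactifiable. -/

import Mathlib

open CategoryTheory

universe u

/-- Two classes of topological spaces are equivalent if every space in either of them is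
homeomorphic to a space in the other one. -/
def ClassEquiv (C D : Set TopCat.{u}) : Prop :=
  (∀ X ∈ C, ∃ Y ∈ D, Nonempty (X ≃ₜ Y)) ∧ (∀ Y ∈ D, ∃ X ∈ C, Nonempty (X ≃ₜ Y))

/-- The family of all fibers of a continuous map `q : A → B`, as subspaces of `A`
(the fiber over a point outside the range of `q` is the empty space). -/
def fiberClass {A B : TopCat.{u}} (q : A ⟶ B) : Set TopCat.{u} :=
  Set.range fun b : B => TopCat.of {a : A // q a = b}

/-- The continuous map `q` is a composition of the class `C`. -/
def IsCompositionOf {A B : TopCat.{u}} (q : A ⟶ B) (C : Set TopCat.{u}) : Prop :=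
  ClassEquiv (fiberClass q) C

/-- A metrizable compactum: a compact metrizable space (possibly empty). -/
def IsMetrizableCompactum (X : TopCat.{u}) : Prop :=
  CompactSpace X ∧ TopologicalSpace.MetrizableSpace X

/-- A class of spaces is Polishable if it has a composition `q : A → B` with `A`, `B` Polish. -/
def IsPolishable (C : Set TopCat.{u}) : Prop :=
  ∃ (A B : TopCat.{u}) (q : A ⟶ B), PolishSpace A ∧ PolishSpace B ∧ IsCompositionOf q C

/-- A class of spaces is compactifiable if it has a composition `q : A → B` with `A`, `B`
metrizable compacta. -/
def IsCompactifiable (C : Set TopCat.{u}) : Prop :=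
  ∃ (A B : TopCat.{u}) (q : A ⟶ B),
    IsMetrizableCompactum A ∧ IsMetrizableCompactum B ∧ IsCompositionOf q C

/-- The limit space of the inverse sequence `X 0 ← X 1 ← X 2 ← ⋯` with bonding maps `f n`, as a
subspace of the product `∏ n, X n`. -/
def inverseLimit (X : ℕ → TopCat.{u}) (f : ∀ n, X (n + 1) ⟶ X n) : TopCat.{u} :=
  TopCat.of {x : ∀ n, X n // ∀ n, x n = f n (x (n + 1))}

/-- The class of all domains and codomains of the maps from `F`. -/
def objClass (F : MorphismProperty TopCat.{u}) : Set TopCat.{u} :=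
  {X | (∃ (Y : TopCat.{u}) (f : X ⟶ Y), F f) ∨ (∃ (Y : TopCat.{u}) (f : Y ⟶ X), F f)}

/-- The class of all `F`-like spaces: the spaces which are (up to homeomorphism) the limit of an
inverse sequence with all bonding maps in `F`. -/
def likeSpaces (F : MorphismProperty TopCat.{u}) : Set TopCat.{u} :=
  {Z | ∃ (X : ℕ → TopCat.{u}) (f : ∀ n, X (n + 1) ⟶ X n),
    (∀ n, F (f n)) ∧ Nonempty (Z ≃ₜ inverseLimit X f)}

/-- The class of all continuous surjections between spaces from `P`. -/
def surjectionsBetween (P : Set TopCat.{u}) : MorphismProperty TopCat.{u} :=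
  fun X Y f => X ∈ P ∧ Y ∈ P ∧ Function.Surjective f

/-- The class of all `P`-like spaces, for a class `P` of topological spaces. -/
def spaceLikeSpaces (P : Set TopCat.{u}) : Set TopCat.{u} :=
  likeSpaces (surjectionsBetween P)

/-- The class of all circle-like spaces, i.e. of all `{S¹}`-like spaces. -/
def circleLikeSpaces : Set TopCat.{u} :=
  spaceLikeSpaces {TopCat.of (ULift.{u} Circle)}

open Topology TopologicalSpace Filter

/-! An inverse sequence is coded by an infinite branch of a tree whose nodes at level `n` are the
composable paths of `n` maps (`pathTower`). With countably many maps the levels are countable and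
discrete, so the branches form a Polish space. Threads in the topological sums of the levels form
another one when the spaces are Polish, and the fiber over a branch is the limit of the sequence it
codes (`SpaceTower.isPolishable`).

For metrizable compacta the maps may be uncountable in number, but `C(X, Y)` is separable, and by
Brown's theorem (`exists_mem_homeomorph_threads`) every limit is also a limit with bonding maps from
countable dense sets. For compactness, each level is replaced by its one-point compactification, the
thread condition being kept only where the next coordinate is finite. A branch that first meets
infinity at level `m + 1` has as fiber the space at its node of level `m`, which is `F`-like by
assumption. Over the branch that is infinite from level 0, a nonempty `F`-like space `Z` is inserted
(`SpaceTower.isCompactifiable`). -/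

/-! ### Embeddings with a common range; one-point compactifications -/

theorem nonempty_homeomorph_of_range_eq {X Y W : Type*} [TopologicalSpace X] [TopologicalSpace Y]
    [TopologicalSpace W] {f : X → W} {g : Y → W} (hf : IsEmbedding f) (hg : IsEmbedding g)
    (h : Set.range f = Set.range g) : Nonempty (X ≃ₜ Y) :=
  ⟨hf.toHomeomorph.trans ((Homeomorph.setCongr h).trans hg.toHomeomorph.symm)⟩

theorem secondCountableTopology_onePoint (X : Type*) [TopologicalSpace X] [LocallyCompactSpace X]
    [T2Space X] [SecondCountableTopology X] : SecondCountableTopology (OnePoint X) := by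
  let K := CompactExhaustion.choice X
  -- Complements of the members of a compact exhaustion form a countable neighborhood base at
  -- infinity.
  let U : Set (Set (OnePoint X)) :=
    (fun s => ((↑) : X → OnePoint X) '' s) '' countableBasis X ∪
      Set.range fun n => (((↑) : X → OnePoint X) '' K n)ᶜ
  have hU : IsTopologicalBasis U := by
    refine isTopologicalBasis_of_isOpen_of_nhds ?_ ?_
    · rintro _ (⟨s, hs, rfl⟩ | ⟨n, rfl⟩)
      · exact OnePoint.isOpen_image_coe.2 (isOpen_of_mem_countableBasis hs)
      · exact OnePoint.isOpen_compl_image_coe.2 ⟨(K.isCompact n).isClosed, K.isCompact n⟩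
    · intro a u ha hu
      induction a using OnePoint.rec with
      | infty =>
        obtain ⟨hc, hk⟩ := (OnePoint.isOpen_iff_of_mem ha).1 hu
        obtain ⟨n, hn⟩ := K.exists_superset_of_isCompact hk
        refine ⟨_, Or.inr ⟨n, rfl⟩, OnePoint.infty_notMem_image_coe, ?_⟩
        intro x hx
        induction x using OnePoint.rec with
        | infty => exact ha
        | coe x =>
          by_contra hxu
          exact hx ⟨x, hn hxu, rfl⟩
      | coe a =>
        obtain ⟨s, hs, has, hsu⟩ := (isBasis_countableBasis X).exists_subset_of_mem_open
          (show a ∈ ((↑) : X → OnePoint X) ⁻¹' u from ha) (hu.preimage OnePoint.continuous_coe)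
        exact ⟨_, Or.inl ⟨s, hs, rfl⟩, ⟨a, has, rfl⟩, Set.image_subset_iff.2 hsu⟩
  exact hU.secondCountableTopology
    (((countable_countableBasis X).image _).union (Set.countable_range _))

/-! ### Threads that may escape to infinity -/

/-- Points of `∏ n, OnePoint (S n)` which are threads of the sequence `S 0 ← S 1 ← ⋯` as long as
they stay away from infinity. -/
def IsOnePointThread {S : ℕ → Type*} (p : ∀ n, S (n + 1) → S n) (x : ∀ n, OnePoint (S n)) : Prop :=
  ∀ n (y : S (n + 1)), x (n + 1) = (y : OnePoint (S (n + 1))) → x n = (p n y : OnePoint (S n))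

namespace IsOnePointThread

variable {S : ℕ → Type*} {p : ∀ n, S (n + 1) → S n} {x x' : ∀ n, OnePoint (S n)}

theorem eq_infty_succ (hx : IsOnePointThread p x) {n : ℕ} (h : x n = OnePoint.infty) :
    x (n + 1) = OnePoint.infty := by
  by_contra hne
  obtain ⟨y, hy⟩ := OnePoint.ne_infty_iff_exists.1 hne
  exact OnePoint.coe_ne_infty _ ((hx n y hy.symm).symm.trans h)

theorem eq_infty_of_le (hx : IsOnePointThread p x) {n m : ℕ} (h : x n = OnePoint.infty)
    (hnm : n ≤ m) : x m = OnePoint.infty := by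
  induction m, hnm using Nat.le_induction with
  | base => exact h
  | succ m _ ih => exact hx.eq_infty_succ ih

theorem eq_of_le (hx : IsOnePointThread p x) (hx' : IsOnePointThread p x') {k m : ℕ} (hkm : k ≤ m)
    (h : x m = x' m) (hne : x m ≠ OnePoint.infty) : x k = x' k := by
  induction m, hkm using Nat.le_induction with
  | base => exact h
  | succ m _ ih =>
    obtain ⟨y, hy⟩ := OnePoint.ne_infty_iff_exists.1 hne
    refine ih ?_ ?_
    · rw [hx m y hy.symm, hx' m y (by rw [← h, hy])]
    · rw [hx m y hy.symm]
      exact OnePoint.coe_ne_infty _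

theorem ext_of_apply_eq (hx : IsOnePointThread p x) (hx' : IsOnePointThread p x') {m : ℕ}
    (h : x m = x' m) (hne : x m ≠ OnePoint.infty) (hs : x (m + 1) = OnePoint.infty)
    (hs' : x' (m + 1) = OnePoint.infty) : x = x' := by
  funext k
  rcases le_or_gt k m with hk | hk
  · exact hx.eq_of_le hx' hk h hne
  · rw [hx.eq_infty_of_le hs hk, hx'.eq_infty_of_le hs' hk]

/-- Below `m` the thread follows the images of `y`. These truncated threads fill the fibers over
branches that end at a node. -/
theorem exists_apply_eq (p : ∀ n, S (n + 1) → S n) (m : ℕ) (y : S m) :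
    ∃ x, IsOnePointThread p x ∧ x m = (y : OnePoint (S m)) ∧ ∀ k, m < k → x k = OnePoint.infty := by
  classical
  induction m with
  | zero =>
    refine ⟨Function.update (fun _ => OnePoint.infty) 0 y, ?_, by simp, ?_⟩
    · intro n z hz
      simp [Function.update_of_ne] at hz
    · intro k hk
      simp [Function.update_of_ne hk.ne']
  | succ m ih =>
    obtain ⟨x, hx, hm, hk⟩ := ih (p m y)
    refine ⟨Function.update x (m + 1) y, ?_, by simp, ?_⟩
    · intro n z hz
      rcases eq_or_ne n m with rfl | hn
      · rw [Function.update_self, OnePoint.coe_eq_coe] at hz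
        rw [Function.update_of_ne (by omega), hm, hz]
      · rw [Function.update_of_ne (by omega)] at hz
        rcases eq_or_ne n (m + 1) with rfl | hn'
        · rw [hk _ (by omega)] at hz
          exact absurd hz (OnePoint.infty_ne_coe _)
        · rw [Function.update_of_ne hn']
          exact hx n z hz
    · intro k hmk
      rw [Function.update_of_ne (by omega)]
      exact hk k (by omega)

theorem map {S' : ℕ → Type*} {p' : ∀ n, S' (n + 1) → S' n} (hx : IsOnePointThread p x)
    (φ : ∀ n, S n → S' n) (hφ : ∀ n y, φ n (p n y) = p' n (φ (n + 1) y)) :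
    IsOnePointThread p' fun n => OnePoint.map (φ n) (x n) := by
  intro n y hy
  have hne : x (n + 1) ≠ OnePoint.infty := by
    intro h
    simp only [h, OnePoint.map_infty] at hy
    exact OnePoint.infty_ne_coe _ hy
  obtain ⟨z, hz⟩ := OnePoint.ne_infty_iff_exists.1 hne
  simp only [← hz, OnePoint.map_some, OnePoint.coe_eq_coe] at hy
  simp only [hx n z hz.symm, OnePoint.map_some, hφ, hy]

end IsOnePointThread

/-- A violation at `n` needs a finite coordinate at `n + 1`, and it is an open condition because `S
(n + 1)` is open in its compactification. Thus `p n` need not extend continuously to infinity, as it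
may fail to when a node has infinitely many children. -/
theorem isClosed_setOf_isOnePointThread {S : ℕ → Type*} [∀ n, TopologicalSpace (S n)]
    [∀ n, LocallyCompactSpace (S n)] [∀ n, T2Space (S n)] {p : ∀ n, S (n + 1) → S n}
    (hp : ∀ n, Continuous (p n)) : IsClosed {x | IsOnePointThread p x} := by
  simp only [IsOnePointThread, Set.ofPred_forall]
  refine isClosed_iInter fun n => ?_
  have ho : IsOpen {w : OnePoint (S n) × S (n + 1) | w.1 ≠ (p n w.2 : OnePoint (S n))} :=
    (isClosed_eq continuous_fst
      (OnePoint.continuous_coe.comp ((hp n).comp continuous_snd))).isOpen_compl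
  have ho' := (IsOpenMap.id.prodMap OnePoint.isOpenMap_coe) _ ho
  have hc : Continuous fun x : ∀ n, OnePoint (S n) => (x n, x (n + 1)) := by fun_prop
  rw [← isOpen_compl_iff]
  convert! ho'.preimage hc using 1
  ext x
  simp only [Set.mem_compl_iff, Set.mem_iInter, Set.mem_ofPred_eq, Set.mem_preimage, Set.mem_image,
    Prod.exists, Prod.map, id, Prod.mk.injEq, not_forall]
  constructor
  · rintro ⟨y, hy, hne⟩
    exact ⟨x n, y, hne, rfl, hy.symm⟩
  · rintro ⟨a, y, hne, rfl, hy⟩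
    exact ⟨y, hy.symm, hne⟩

/-! ### Brown's approximation theorem -/

section Approximation

variable {X : ℕ → Type u}

/-- Push `x (n + k)` down to level `n` by the maps `f` alone. Passing from `k` to `k + 1` replaces
one `g` by `f`, and the error is not expanded on the way down, so the results are Cauchy in `k`. -/
theorem exists_thread_dist_le [∀ n, MetricSpace (X n)] [∀ n, CompleteSpace (X n)]
    {f g : ∀ n, X (n + 1) → X n} (hf : ∀ n, LipschitzWith 1 (f n))
    (hfg : ∀ n x, dist (f n x) (g n x) ≤ 1 / 2 ^ n) {x : ∀ n, X n}
    (hx : ∀ n, x n = g n (x (n + 1))) :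
    ∃ y : ∀ n, X n, (∀ n, y n = f n (y (n + 1))) ∧ ∀ n, dist (x n) (y n) ≤ 2 / 2 ^ n := by
  let Y : ℕ → ∀ n, X n := fun k => Nat.rec x (fun _ z n => f n (z (n + 1))) k
  have hY : ∀ k n, Y (k + 1) n = f n (Y k (n + 1)) := fun k n => rfl
  -- The bound is `1 / 2 ^ (n + k)`, in the shape the geometric-series lemmas expect.
  have hd : ∀ k n, dist (Y k n) (Y (k + 1) n) ≤ 2 / 2 ^ n / 2 / 2 ^ k := by
    intro k
    induction k with
    | zero =>
      intro n
      have h : dist (x n) (f n (x (n + 1))) ≤ 1 / 2 ^ n := by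
        have h := hfg n (x (n + 1))
        rwa [← hx n, dist_comm] at h
      refine h.trans (le_of_eq ?_)
      field_simp
    | succ k ih =>
      intro n
      have h := (hf n).dist_le_mul (Y k (n + 1)) (Y (k + 1) (n + 1))
      rw [NNReal.coe_one, one_mul] at h
      refine (h.trans (ih (n + 1))).trans (le_of_eq ?_)
      field_simp
      ring
  choose y hy using fun n => cauchySeq_tendsto_of_complete
    (cauchySeq_of_le_geometric_two (fun k => hd k n))
  refine ⟨y, fun n => ?_, fun n => dist_le_of_le_geometric_two_of_tendsto₀ (fun k => hd k n) (hy n)⟩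
  refine tendsto_nhds_unique ((tendsto_add_atTop_iff_nat 1).2 (hy n)) ?_
  exact ((hf n).continuous.tendsto _).comp (hy (n + 1))

theorem dist_apply_le_of_thread [∀ n, MetricSpace (X n)] {f : ∀ n, X (n + 1) → X n}
    (hf : ∀ n, LipschitzWith 1 (f n)) {y y' : ∀ n, X n} (hy : ∀ n, y n = f n (y (n + 1)))
    (hy' : ∀ n, y' n = f n (y' (n + 1))) {n m : ℕ} (hnm : n ≤ m) :
    dist (y n) (y' n) ≤ dist (y m) (y' m) := by
  refine monotone_nat_of_le_succ (f := fun n => dist (y n) (y' n)) (fun n => ?_) hnm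
  have h := (hf n).dist_le_mul (y (n + 1)) (y' (n + 1))
  rwa [NNReal.coe_one, one_mul, ← hy, ← hy'] at h

theorem exists_div_two_pow_lt (C : ℝ) {ε : ℝ} (hε : 0 < ε) (n : ℕ) :
    ∃ m, n ≤ m ∧ C / 2 ^ m < ε := by
  have h : Tendsto (fun m : ℕ => C / 2 ^ m) atTop (𝓝 0) := by
    simpa [div_eq_mul_inv] using
      (tendsto_pow_atTop_nhds_zero_of_lt_one (r := (2 : ℝ)⁻¹) (by norm_num)
        (by norm_num)).const_mul C
  obtain ⟨m, hm, hm'⟩ := ((h.eventually_lt_const hε).and (eventually_ge_atTop n)).exists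
  exact ⟨m, hm', hm⟩

/-- Nonexpanding bonding maps make the distance between two threads nondecreasing in the level, so a
bound tending to zero forces equality. -/
theorem eq_of_thread_of_dist_le [∀ n, MetricSpace (X n)] {f : ∀ n, X (n + 1) → X n}
    (hf : ∀ n, LipschitzWith 1 (f n)) {y y' : ∀ n, X n} (hy : ∀ n, y n = f n (y (n + 1)))
    (hy' : ∀ n, y' n = f n (y' (n + 1))) {C : ℝ} (h : ∀ n, dist (y n) (y' n) ≤ C / 2 ^ n) :
    y = y' := by
  funext n
  refine dist_le_zero.1 (le_of_forall_pos_le_add fun ε hε => ?_)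
  obtain ⟨m, hnm, hm⟩ := exists_div_two_pow_lt C hε n
  rw [zero_add]
  exact (dist_apply_le_of_thread hf hy hy' hnm).trans ((h m).trans hm.le)

theorem continuous_of_thread_of_dist_le [∀ n, MetricSpace (X n)] {f g : ∀ n, X (n + 1) → X n}
    (hf : ∀ n, LipschitzWith 1 (f n))
    (h : {x : ∀ n, X n // ∀ n, x n = g n (x (n + 1))} → {x : ∀ n, X n // ∀ n, x n = f n (x (n + 1))})
    (hd : ∀ x n, dist (x.1 n) ((h x).1 n) ≤ 2 / 2 ^ n) : Continuous h := by
  refine Continuous.subtype_mk (f := fun x => (h x).1) (continuous_pi fun n => ?_) fun x => (h x).2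
  rw [continuous_iff_continuousAt]
  intro a
  rw [ContinuousAt, Metric.tendsto_nhds]
  intro ε hε
  -- Level `m` controls level `n`; there `h` moves each of the two threads by at most `2 / 2 ^ m`,
  -- together `4 / 2 ^ m`.
  obtain ⟨m, hnm, hm⟩ := exists_div_two_pow_lt 4 (half_pos hε) n
  have hc : Continuous fun x : {x : ∀ n, X n // ∀ n, x n = g n (x (n + 1))} => x.1 m :=
    (continuous_apply m).comp continuous_subtype_val
  filter_upwards [Metric.tendsto_nhds.1 (hc.tendsto a) (ε / 2) (half_pos hε)] with x hx
  have h1 := dist_apply_le_of_thread hf (h x).2 (h a).2 hnm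
  have h2 := dist_triangle4 ((h x).1 m) (x.1 m) (a.1 m) ((h a).1 m)
  have h3 := hd x m
  have h4 := hd a m
  rw [dist_comm] at h3
  have h5 : (2 : ℝ) / 2 ^ m + 2 / 2 ^ m = 4 / 2 ^ m := by ring
  linarith

/-- Going to the other limit and back moves level `n` by at most `4 / 2 ^ n`, so the round trip is
the identity by `eq_of_thread_of_dist_le`. -/
theorem nonempty_homeomorph_threads_of_dist_le [∀ n, MetricSpace (X n)]
    [∀ n, CompleteSpace (X n)] {f g : ∀ n, X (n + 1) → X n} (hf : ∀ n, LipschitzWith 1 (f n))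
    (hg : ∀ n, LipschitzWith 1 (g n)) (hfg : ∀ n x, dist (f n x) (g n x) ≤ 1 / 2 ^ n) :
    Nonempty ({x : ∀ n, X n // ∀ n, x n = f n (x (n + 1))} ≃ₜ
      {x : ∀ n, X n // ∀ n, x n = g n (x (n + 1))}) := by
  have hgf : ∀ n x, dist (g n x) (f n x) ≤ 1 / 2 ^ n := fun n x => by
    rw [dist_comm]
    exact hfg n x
  choose a ha had using fun x : {x : ∀ n, X n // ∀ n, x n = f n (x (n + 1))} =>
    exists_thread_dist_le hg hgf x.2
  choose b hb hbd using fun x : {x : ∀ n, X n // ∀ n, x n = g n (x (n + 1))} =>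
    exists_thread_dist_le hf hfg x.2
  have hadd : ∀ {n : ℕ} {r s : ℝ}, r ≤ 2 / 2 ^ n → s ≤ 2 / 2 ^ n → r + s ≤ 4 / 2 ^ n := by
    intro n r s hr hs
    have h5 : (2 : ℝ) / 2 ^ n + 2 / 2 ^ n = 4 / 2 ^ n := by ring
    linarith
  exact ⟨{
    toFun := fun x => ⟨a x, ha x⟩
    invFun := fun x => ⟨b x, hb x⟩
    left_inv := fun x => Subtype.ext <| Eq.symm <|
      eq_of_thread_of_dist_le hf x.2 (hb ⟨a x, ha x⟩) fun n =>
        (dist_triangle _ _ _).trans (hadd (had x n) (hbd ⟨a x, ha x⟩ n))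
    right_inv := fun x => Subtype.ext <| Eq.symm <|
      eq_of_thread_of_dist_le hg x.2 (ha ⟨b x, hb x⟩) fun n =>
        (dist_triangle _ _ _).trans (hadd (hbd x n) (had ⟨b x, hb x⟩ n))
    continuous_toFun := continuous_of_thread_of_dist_le hg (fun x => ⟨a x, ha x⟩) had
    continuous_invFun := continuous_of_thread_of_dist_le hf (fun x => ⟨b x, hb x⟩) hbd }⟩

/-- A metric compatible with a given topology. -/
abbrev CompatibleMetric (Y : Type*) [t : TopologicalSpace Y] :=
  {m : MetricSpace Y // m.toUniformSpace.toTopologicalSpace = t}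

theorem exists_compatibleMetric_lipschitz {Y Z : Type*} [tY : TopologicalSpace Y]
    [TopologicalSpace Z] [MetrizableSpace Y] (ρ : CompatibleMetric Z) (f g : C(Y, Z)) :
    ∃ σ : CompatibleMetric Y, ∀ y y', ρ.1.dist (f y) (f y') ≤ σ.1.dist y y' ∧
      ρ.1.dist (g y) (g y') ≤ σ.1.dist y y' := by
  obtain ⟨ρ, rfl⟩ := ρ
  let _ := metrizableSpaceMetric Y
  -- The maximum metric pulled back along this graph embedding dominates both pulled-back distances.
  have he : IsEmbedding fun y : Y => (y, f y, g y) :=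
    IsEmbedding.of_comp (by fun_prop) continuous_fst IsEmbedding.id
  refine ⟨⟨he.comapMetricSpace, rfl⟩, fun y y' => ⟨?_, ?_⟩⟩
  · exact (le_max_left _ _).trans (le_max_right _ _)
  · exact (le_max_right _ _).trans (le_max_right _ _)

theorem exists_mem_dist_le_of_mem_closure {Y Z : Type*} [TopologicalSpace Y] [CompactSpace Y]
    [TopologicalSpace Z] (ρ : CompatibleMetric Z) {f : C(Y, Z)} {K : Set C(Y, Z)}
    (hf : f ∈ closure K) {ε : ℝ} (hε : 0 < ε) : ∃ g ∈ K, ∀ y, ρ.1.dist (f y) (g y) ≤ ε := by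
  obtain ⟨ρ, rfl⟩ := ρ
  obtain ⟨g, hg, hd⟩ := Metric.mem_closure_iff.1 hf ε hε
  exact ⟨g, hg, (ContinuousMap.dist_le hε.le).1 hd.le⟩

theorem nonempty_homeomorph_threads_of_compatibleMetric [t : ∀ n, TopologicalSpace (X n)]
    [∀ n, CompactSpace (X n)] (m : ∀ n, MetricSpace (X n))
    (hm : ∀ n, (m n).toUniformSpace.toTopologicalSpace = t n) {f g : ∀ n, X (n + 1) → X n}
    (hf : ∀ n x y, (m n).dist (f n x) (f n y) ≤ (m (n + 1)).dist x y)
    (hg : ∀ n x y, (m n).dist (g n x) (g n y) ≤ (m (n + 1)).dist x y)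
    (hfg : ∀ n x, (m n).dist (f n x) (g n x) ≤ 1 / 2 ^ n) :
    Nonempty ({x : ∀ n, X n // ∀ n, x n = f n (x (n + 1))} ≃ₜ
      {x : ∀ n, X n // ∀ n, x n = g n (x (n + 1))}) := by
  -- Makes the given topologies literally those of the metrics.
  obtain rfl := funext hm
  exact nonempty_homeomorph_threads_of_dist_le
    (fun n => LipschitzWith.of_dist_le_mul fun x y => by
      rw [NNReal.coe_one, one_mul]; exact hf n x y)
    (fun n => LipschitzWith.of_dist_le_mul fun x y => by
      rw [NNReal.coe_one, one_mul]; exact hg n x y) hfg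

/-- **Brown's approximation theorem** for inverse sequences of metrizable compacta. -/
theorem exists_mem_homeomorph_threads [∀ n, TopologicalSpace (X n)] [∀ n, CompactSpace (X n)]
    [∀ n, MetrizableSpace (X n)] (f : ∀ n, C(X (n + 1), X n)) (K : ∀ n, Set C(X (n + 1), X n))
    (hK : ∀ n, f n ∈ closure (K n)) :
    ∃ g : ∀ n, C(X (n + 1), X n), (∀ n, g n ∈ K n) ∧
      Nonempty ({x : ∀ n, X n // ∀ n, x n = f n (x (n + 1))} ≃ₜ
        {x : ∀ n, X n // ∀ n, x n = g n (x (n + 1))}) := by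
  choose G hG hGd using fun n (ρ : CompatibleMetric (X n)) =>
    exists_mem_dist_le_of_mem_closure ρ (hK n) (ε := 1 / 2 ^ n) (by positivity)
  choose R hR using fun n (ρ : CompatibleMetric (X n)) =>
    exists_compatibleMetric_lipschitz ρ (f n) (G n ρ)
  -- The metric on `X n` determines the approximation `g n`, and only then is the metric on `X (n +
  -- 1)` chosen to make `f n` and `g n` nonexpanding.
  let ρ : ∀ n, CompatibleMetric (X n) := fun n =>
    Nat.rec ⟨metrizableSpaceMetric (X 0), rfl⟩ (fun n r => R n r) n
  exact ⟨fun n => G n (ρ n), fun n => hG n _,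
    nonempty_homeomorph_threads_of_compatibleMetric (fun n => (ρ n).1) (fun n => (ρ n).2)
      (fun n x y => (hR n (ρ n) x y).1) (fun n x y => (hR n (ρ n) x y).2) fun n x => hGd n (ρ n) x⟩

end Approximation

/-! ### Towers of spaces and their Polish compositions -/

/-- A sequence of countable levels of nodes, where every node carries a space and has a parent in
the previous level to whose space its own space is mapped. -/
structure SpaceTower where
  /-- The nodes of a level. -/
  node : ℕ → Type u
  countable : ∀ n, Countable (node n)
  /-- The space at a node. -/
  space : ∀ n, node n → TopCat.{u}
  /-- The parent of a node. -/
  parent : ∀ n, node (n + 1) → node n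
  /-- The map from the space at a node to the space at its parent. -/
  bond : ∀ n (t : node (n + 1)), space (n + 1) t ⟶ space n (parent n t)

namespace SpaceTower

variable (T : SpaceTower.{u})

/-- The nodes of a level form a discrete space. -/
instance (n : ℕ) : TopologicalSpace (T.node n) := ⊥

instance (n : ℕ) : DiscreteTopology (T.node n) := ⟨rfl⟩

instance (n : ℕ) : Countable (T.node n) := T.countable n

/-- The topological sum of all spaces of a level. -/
abbrev Total (n : ℕ) : Type u := Σ s : T.node n, T.space n s

/-- The map between the topological sums of consecutive levels. -/
def proj (n : ℕ) : T.Total (n + 1) → T.Total n :=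
  Sigma.map (T.parent n) fun t => T.bond n t

theorem continuous_proj (n : ℕ) : Continuous (T.proj n) :=
  Continuous.sigma_map fun t => (T.bond n t).hom.continuous

theorem continuous_fst (n : ℕ) : Continuous (Sigma.fst : T.Total n → T.node n) :=
  continuous_sigma fun _ => continuous_const

/-- Infinite branches of the tree of nodes. -/
def IsBranch (b : ∀ n, T.node n) : Prop := ∀ n, b n = T.parent n (b (n + 1))

variable {T}

/-- The bonding maps along a branch. -/
def branchMap {b : ∀ n, T.node n} (hb : T.IsBranch b) (n : ℕ) :
    T.space (n + 1) (b (n + 1)) ⟶ T.space n (b n) :=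
  T.bond n (b (n + 1)) ≫ eqToHom (congrArg (T.space n) (hb n).symm)

theorem mk_branchMap {b : ∀ n, T.node n} (hb : T.IsBranch b) (n : ℕ)
    (x : T.space (n + 1) (b (n + 1))) :
    (⟨b n, branchMap hb n x⟩ : T.Total n) = T.proj n ⟨b (n + 1), x⟩ := by
  -- Freeing the endpoint `s` lets the transport along the branch equation be eliminated by
  -- substitution.
  have h : ∀ (s : T.node n) (h : T.parent n (b (n + 1)) = s),
      (⟨s, (T.bond n (b (n + 1)) ≫ eqToHom (congrArg (T.space n) h)) x⟩ : T.Total n) =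
        T.proj n ⟨b (n + 1), x⟩ := by
    rintro _ rfl
    simp [proj, Sigma.map]
  exact h _ (hb n).symm

theorem branchMap_mem {b : ∀ n, T.node n} (hb : T.IsBranch b) (n : ℕ)
    {F : MorphismProperty TopCat.{u}} (hF : F (T.bond n (b (n + 1)))) : F (branchMap hb n) := by
  have h : ∀ (s : T.node n) (h : T.parent n (b (n + 1)) = s),
      F (T.bond n (b (n + 1)) ≫ eqToHom (congrArg (T.space n) h)) := by
    rintro _ rfl
    simpa using hF
  exact h _ (hb n).symm

/-- A point of the limit along a branch as a sequence of points of the topological sums. -/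
def branchEmb {b : ∀ n, T.node n} (hb : T.IsBranch b)
    (x : inverseLimit (fun n => T.space n (b n)) (branchMap hb)) : ∀ n, T.Total n :=
  fun n => ⟨b n, x.1 n⟩

theorem isEmbedding_branchEmb {b : ∀ n, T.node n} (hb : T.IsBranch b) :
    IsEmbedding (branchEmb hb) :=
  (IsEmbedding.piMap fun n => IsEmbedding.sigmaMk (σ := fun s => T.space n s) (i := b n)).comp
    IsEmbedding.subtypeVal

theorem range_branchEmb {b : ∀ n, T.node n} (hb : T.IsBranch b) :
    Set.range (branchEmb hb) =
      {x | (∀ n, x n = T.proj n (x (n + 1))) ∧ ∀ n, (x n).1 = b n} := by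
  ext x
  constructor
  · rintro ⟨y, rfl⟩
    refine ⟨fun n => ?_, fun n => rfl⟩
    rw [branchEmb, branchEmb, ← mk_branchMap hb, ← y.2 n]
  · rintro ⟨hx, hxb⟩
    have hex : ∀ n, ∃ y : T.space n (b n), x n = ⟨b n, y⟩ := fun n => by
      have := hxb n
      generalize b n = c at this
      subst this
      exact ⟨_, rfl⟩
    choose y hy using hex
    refine ⟨⟨y, fun n => ?_⟩, funext fun n => (hy n).symm⟩
    have h := hx n
    rw [hy n, hy (n + 1), ← mk_branchMap hb] at h
    exact eq_of_heq (Sigma.mk.inj h).2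

theorem isPolishable {C : Set TopCat.{u}} (hT : ∀ n s, PolishSpace (T.space n s))
    (hbC : ∀ b, ∀ hb : T.IsBranch b,
      inverseLimit (fun n => T.space n (b n)) (branchMap hb) ∈ C)
    (hCb : ∀ Y ∈ C, ∃ b, ∃ hb : T.IsBranch b,
      Nonempty (Y ≃ₜ inverseLimit (fun n => T.space n (b n)) (branchMap hb))) :
    IsPolishable C := by
  have hA : IsClosed {x : ∀ n, T.Total n | ∀ n, x n = T.proj n (x (n + 1))} := by
    simp only [Set.ofPred_forall]
    exact isClosed_iInter fun n => isClosed_eq (continuous_apply n)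
      ((T.continuous_proj n).comp (continuous_apply (n + 1)))
  have hB : IsClosed {b | T.IsBranch b} := by
    simp only [IsBranch, Set.ofPred_forall]
    exact isClosed_iInter fun n => isClosed_eq (continuous_apply n)
      ((continuous_of_discreteTopology (f := T.parent n)).comp (continuous_apply (n + 1)))
  let A : TopCat.{u} := TopCat.of {x : ∀ n, T.Total n | ∀ n, x n = T.proj n (x (n + 1))}
  let B : TopCat.{u} := TopCat.of {b | T.IsBranch b}
  have hq : Continuous fun x : A => (fun n => (x.1 n).1 : ∀ n, T.node n) :=
    continuous_pi fun n => (T.continuous_fst n).comp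
      ((continuous_apply n).comp continuous_subtype_val)
  let q : A ⟶ B := TopCat.ofHom
    ⟨fun x => ⟨fun n => (x.1 n).1, fun n => congrArg Sigma.fst (x.2 n)⟩, hq.subtype_mk _⟩
  have key : ∀ b : B, Nonempty ({a : A // q a = b} ≃ₜ
      inverseLimit (fun n => T.space n (b.1 n)) (branchMap b.2)) := by
    intro b
    refine nonempty_homeomorph_of_range_eq
      (IsEmbedding.subtypeVal.comp IsEmbedding.subtypeVal) (isEmbedding_branchEmb b.2) ?_
    rw [range_branchEmb]
    ext x
    constructor
    · rintro ⟨⟨a, rfl⟩, rfl⟩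
      exact ⟨a.2, fun n => rfl⟩
    · rintro ⟨hx, hxb⟩
      exact ⟨⟨⟨x, hx⟩, Subtype.ext (funext hxb)⟩, rfl⟩
  refine ⟨A, B, q, hA.polishSpace, hB.polishSpace, ?_, ?_⟩
  · rintro _ ⟨b, rfl⟩
    exact ⟨_, hbC b.1 b.2, key b⟩
  · intro Y hY
    obtain ⟨b, hb, ⟨e⟩⟩ := hCb Y hY
    obtain ⟨e'⟩ := key ⟨b, hb⟩
    exact ⟨_, ⟨⟨b, hb⟩, rfl⟩, ⟨e'.trans e.symm⟩⟩

/-! ### The compact composition of a tower -/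

variable (T)

/-- The projection to nodes is proper: a compact set of nodes is finite, so its preimage is a finite
union of compact spaces. -/
theorem continuous_map_fst [∀ n s, CompactSpace (T.space n s)] (n : ℕ) :
    Continuous (OnePoint.map (Sigma.fst : T.Total n → T.node n)) := by
  refine OnePoint.continuous_map (T.continuous_fst n) ?_
  rw [hasBasis_coclosedCompact.tendsto_iff hasBasis_coclosedCompact]
  rintro K ⟨hK, hKc⟩
  refine ⟨Sigma.fst ⁻¹' K, ⟨hK.preimage (T.continuous_fst n), ?_⟩, fun x hx => hx⟩
  have h : (Sigma.fst ⁻¹' K : Set (T.Total n)) = ⋃ s ∈ K, Set.range (Sigma.mk s) := by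
    ext ⟨s, x⟩
    simp only [Set.mem_preimage, Set.mem_iUnion, Set.mem_range]
    constructor
    · exact fun hs => ⟨s, hs, x, rfl⟩
    · rintro ⟨s', hs', y, hy⟩
      obtain rfl := congrArg Sigma.fst hy
      exact hs'
  rw [h]
  exact hKc.finite_of_discrete.isCompact_biUnion fun s _ => isCompact_range continuous_sigmaMk

instance (n : ℕ) : SecondCountableTopology (OnePoint (T.node n)) :=
  secondCountableTopology_onePoint _

/-- The base space of the composition of metrizable compacta associated to a tower. -/
abbrev CompactBase : Type u :=
  {b : ∀ n, OnePoint (T.node n) | IsOnePointThread T.parent b}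

theorem isMetrizableCompactum_compactBase :
    IsMetrizableCompactum (TopCat.of T.CompactBase) := by
  have hc := isClosed_setOf_isOnePointThread (p := T.parent)
    fun n => continuous_of_discreteTopology
  exact ⟨isCompact_iff_compactSpace.1 hc.isCompact,
    (inferInstance : MetrizableSpace T.CompactBase)⟩

section Compact

variable [∀ n s, CompactSpace (T.space n s)] [∀ n s, MetrizableSpace (T.space n s)]
  (Z : TopCat.{u}) (z₀ : Z)

instance (n : ℕ) : LocallyCompactSpace (T.Total n) := by
  have : WeaklyLocallyCompactSpace (T.Total n) := ⟨fun x =>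
    ⟨_, isCompact_range (continuous_sigmaMk (i := x.1)), (isOpenMap_sigmaMk.isOpen_range).mem_nhds
      ⟨x.2, rfl⟩⟩⟩
  infer_instance

instance (n : ℕ) : SecondCountableTopology (OnePoint (T.Total n)) :=
  secondCountableTopology_onePoint _

/-- The total space of the composition of metrizable compacta associated to a tower: one-point
threads of topological sums, with the thread at infinity blown up to the space `Z`. -/
abbrev CompactTotal : Type u :=
  {w : (∀ n, OnePoint (T.Total n)) × Z |
    IsOnePointThread T.proj w.1 ∧ (w.1 0 = OnePoint.infty ∨ w.2 = z₀)}

theorem isClosed_compactTotal [T1Space Z] :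
    IsClosed {w : (∀ n, OnePoint (T.Total n)) × Z |
      IsOnePointThread T.proj w.1 ∧ (w.1 0 = OnePoint.infty ∨ w.2 = z₀)} := by
  refine ((isClosed_setOf_isOnePointThread T.continuous_proj).preimage _root_.continuous_fst).inter ?_
  exact (OnePoint.isClosed_infty.preimage
    (f := fun w : (∀ n, OnePoint (T.Total n)) × Z => w.1 0) (by fun_prop)).union
    (isClosed_singleton.preimage continuous_snd)

theorem isMetrizableCompactum_compactTotal (hZ : IsMetrizableCompactum Z) :
    IsMetrizableCompactum (TopCat.of (T.CompactTotal Z z₀)) := by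
  obtain ⟨_, _⟩ := hZ
  have hc := T.isClosed_compactTotal Z z₀
  have : SecondCountableTopology Z := by
    let _ := metrizableSpaceMetric Z
    infer_instance
  exact ⟨isCompact_iff_compactSpace.1 hc.isCompact,
    (inferInstance : MetrizableSpace (T.CompactTotal Z z₀))⟩

end Compact

theorem isBranch_of_coe {T : SpaceTower.{u}} {b : T.CompactBase} {c : ∀ n, T.node n}
    (h : ∀ n, b.1 n = (c n : OnePoint (T.node n))) : T.IsBranch c := by
  intro n
  have := b.2 n _ (h (n + 1))
  rwa [h n, OnePoint.coe_eq_coe] at this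

section Compact

variable [∀ n s, CompactSpace (T.space n s)] (Z : TopCat.{u}) (z₀ : Z)

/-- The composition of metrizable compacta associated to a tower. -/
def compactMap : TopCat.of (T.CompactTotal Z z₀) ⟶ TopCat.of T.CompactBase :=
  TopCat.ofHom
    ⟨fun w => ⟨fun n => OnePoint.map Sigma.fst (w.1.1 n), w.2.1.map (fun _ => Sigma.fst)
        fun _ _ => rfl⟩,
      Continuous.subtype_mk (continuous_pi fun n => (T.continuous_map_fst n).comp
        ((continuous_apply n).comp (_root_.continuous_fst.comp continuous_subtype_val))) _⟩

/-- The fibers of the composition of metrizable compacta associated to a tower. -/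
abbrev CompactFiber (b : T.CompactBase) : Type u :=
  {w : TopCat.of (T.CompactTotal Z z₀) // T.compactMap Z z₀ w = b}

variable {T Z z₀}

theorem map_apply_eq {b : T.CompactBase} (w : T.CompactFiber Z z₀ b) (n : ℕ) :
    OnePoint.map Sigma.fst (w.1.1.1 n) = b.1 n :=
  congrFun (congrArg Subtype.val w.2) n

theorem apply_eq_infty {b : T.CompactBase} (w : T.CompactFiber Z z₀ b) {n : ℕ}
    (h : b.1 n = OnePoint.infty) : w.1.1.1 n = OnePoint.infty := by
  by_contra hne
  obtain ⟨y, hy⟩ := OnePoint.ne_infty_iff_exists.1 hne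
  have := map_apply_eq w n
  rw [← hy, h] at this
  exact OnePoint.coe_ne_infty _ this

theorem exists_apply_eq {b : T.CompactBase} (w : T.CompactFiber Z z₀ b) {n : ℕ} {t : T.node n}
    (h : b.1 n = (t : OnePoint (T.node n))) :
    ∃ y : T.space n t, w.1.1.1 n = ((⟨t, y⟩ : T.Total n) : OnePoint (T.Total n)) := by
  have hm := map_apply_eq w n
  rw [h] at hm
  have hne : w.1.1.1 n ≠ OnePoint.infty := by
    intro h'
    rw [h'] at hm
    exact OnePoint.infty_ne_coe _ hm
  obtain ⟨⟨s, y⟩, hy⟩ := OnePoint.ne_infty_iff_exists.1 hne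
  rw [← hy, OnePoint.map_some, OnePoint.coe_eq_coe] at hm
  dsimp only at hm
  subst hm
  exact ⟨y, hy.symm⟩

theorem snd_eq {b : T.CompactBase} (w : T.CompactFiber Z z₀ b) (h : b.1 0 ≠ OnePoint.infty) :
    w.1.1.2 = z₀ := by
  refine w.1.2.2.resolve_left fun h' => h ?_
  rw [← map_apply_eq w 0, h', OnePoint.map_infty]

theorem nonempty_homeomorph_branch {b : T.CompactBase} {c : ∀ n, T.node n}
    (h : ∀ n, b.1 n = (c n : OnePoint (T.node n))) (hc : T.IsBranch c) :
    Nonempty (T.CompactFiber Z z₀ b ≃ₜ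
      inverseLimit (fun n => T.space n (c n)) (branchMap hc)) := by
  have hz : b.1 0 ≠ OnePoint.infty := by
    rw [h 0]
    exact OnePoint.coe_ne_infty _
  have hg : IsEmbedding fun x : inverseLimit (fun n => T.space n (c n)) (branchMap hc) =>
      ((fun n => (branchEmb hc x n : OnePoint (T.Total n)), z₀) : (∀ n, OnePoint (T.Total n)) × Z) :=
    (isEmbedding_prodMkLeft z₀).comp
      ((IsEmbedding.piMap fun n => OnePoint.isOpenEmbedding_coe.isEmbedding).comp
        (isEmbedding_branchEmb hc))
  refine nonempty_homeomorph_of_range_eq (IsEmbedding.subtypeVal.comp IsEmbedding.subtypeVal) hg ?_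
  ext w
  constructor
  · rintro ⟨w, rfl⟩
    choose y hy using fun n => exists_apply_eq w (h n)
    have hx : (fun n => (⟨c n, y n⟩ : T.Total n)) ∈ Set.range (branchEmb hc) := by
      rw [range_branchEmb]
      refine ⟨fun n => ?_, fun n => rfl⟩
      have := w.1.2.1 n _ (hy (n + 1))
      rwa [hy n, OnePoint.coe_eq_coe] at this
    obtain ⟨x, hx⟩ := hx
    refine ⟨x, Prod.ext (funext fun n => ?_) (snd_eq w hz).symm⟩
    exact (congrArg _ (congrFun hx n)).trans (hy n).symm
  · rintro ⟨x, rfl⟩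
    have hx : branchEmb hc x ∈ Set.range (branchEmb hc) := ⟨x, rfl⟩
    rw [range_branchEmb] at hx
    refine ⟨⟨⟨⟨fun n => (branchEmb hc x n : OnePoint (T.Total n)), z₀⟩, ?_, Or.inr rfl⟩,
      Subtype.ext (funext fun n => ?_)⟩, rfl⟩
    · intro n y hy
      rw [OnePoint.coe_eq_coe] at hy ⊢
      rw [hx.1 n, hy]
    · exact (h n).symm

/-- A point of such a fiber is determined by its coordinate `m`: lower coordinates are images of it,
higher ones are infinite, and the `Z`-coordinate is `z₀`. -/
theorem nonempty_homeomorph_node [∀ n s, MetrizableSpace (T.space n s)]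
    (hZ : IsMetrizableCompactum Z) {b : T.CompactBase} {m : ℕ}
    {t : T.node m} (h : b.1 m = (t : OnePoint (T.node m))) (hs : b.1 (m + 1) = OnePoint.infty) :
    Nonempty (T.CompactFiber Z z₀ b ≃ₜ T.space m t) := by
  obtain ⟨_, _⟩ := hZ
  have hne : b.1 m ≠ OnePoint.infty := by
    rw [h]
    exact OnePoint.coe_ne_infty _
  have hz : b.1 0 ≠ OnePoint.infty := fun h0 => hne (b.2.eq_infty_of_le h0 (Nat.zero_le m))
  have hA : CompactSpace (TopCat.of (T.CompactTotal Z z₀)) :=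
    (T.isMetrizableCompactum_compactTotal Z z₀ ⟨‹_›, ‹_›⟩).1
  have : CompactSpace (T.CompactFiber Z z₀ b) := isCompact_iff_compactSpace.1
    (isClosed_eq (f := T.compactMap Z z₀) (g := fun _ => b)
      (T.compactMap Z z₀).hom.continuous continuous_const).isCompact
  have hf : Continuous fun w : T.CompactFiber Z z₀ b => w.1.1.1 m :=
    (continuous_apply m).comp
      (_root_.continuous_fst.comp (continuous_subtype_val.comp continuous_subtype_val))
  have hfi : Function.Injective fun w : T.CompactFiber Z z₀ b => w.1.1.1 m := by
    intro w w' hw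
    refine Subtype.ext (Subtype.ext (Prod.ext ?_ ((snd_eq w hz).trans (snd_eq w' hz).symm)))
    refine w.1.2.1.ext_of_apply_eq w'.1.2.1 hw ?_ (apply_eq_infty w hs) (apply_eq_infty w' hs)
    obtain ⟨y, hy⟩ := exists_apply_eq w h
    rw [hy]
    exact OnePoint.coe_ne_infty _
  have hg : IsEmbedding fun y : T.space m t =>
      ((⟨t, y⟩ : T.Total m) : OnePoint (T.Total m)) :=
    OnePoint.isOpenEmbedding_coe.isEmbedding.comp IsEmbedding.sigmaMk
  refine nonempty_homeomorph_of_range_eq (hf.isClosedEmbedding hfi).isEmbedding hg ?_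
  ext a
  constructor
  · rintro ⟨w, rfl⟩
    obtain ⟨y, hy⟩ := exists_apply_eq w h
    exact ⟨y, hy.symm⟩
  · rintro ⟨y, rfl⟩
    obtain ⟨x, hx, hxm, hxk⟩ := IsOnePointThread.exists_apply_eq T.proj m ⟨t, y⟩
    -- The truncated thread lies over `b`, since its image agrees with `b` at `m` and both are
    -- infinite at `m + 1`.
    refine ⟨⟨⟨⟨x, z₀⟩, hx, Or.inr rfl⟩, Subtype.ext ?_⟩, hxm⟩
    refine (hx.map (p' := T.parent) (fun _ => Sigma.fst) fun _ _ => rfl).ext_of_apply_eq b.2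
      (m := m) ?_ ?_ ?_ hs
    · simp only [hxm, OnePoint.map_some, h]
    · simp only [hxm, OnePoint.map_some]
      exact OnePoint.coe_ne_infty _
    · simp only [hxk _ (Nat.lt_succ_self m), OnePoint.map_infty]

/-- This is what the factor `Z` is for: without it the fiber would be a single point, which need not
belong to the class. -/
theorem nonempty_homeomorph_infty {b : T.CompactBase} (h : b.1 0 = OnePoint.infty) :
    Nonempty (T.CompactFiber Z z₀ b ≃ₜ Z) := by
  have hb : ∀ n, b.1 n = OnePoint.infty := fun n => b.2.eq_infty_of_le h (Nat.zero_le n)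
  have hg : IsEmbedding fun z : Z =>
      ((fun _ => OnePoint.infty, z) : (∀ n, OnePoint (T.Total n)) × Z) :=
    isEmbedding_prodMkRight _
  refine nonempty_homeomorph_of_range_eq (IsEmbedding.subtypeVal.comp IsEmbedding.subtypeVal) hg ?_
  ext w
  constructor
  · rintro ⟨w, rfl⟩
    exact ⟨w.1.1.2, Prod.ext (funext fun n => (apply_eq_infty w (hb n)).symm) rfl⟩
  · rintro ⟨z, rfl⟩
    refine ⟨⟨⟨⟨fun _ => OnePoint.infty, z⟩, fun n y hy => ?_, Or.inl rfl⟩,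
      Subtype.ext (funext fun n => ?_)⟩, rfl⟩
    · exact absurd hy (OnePoint.infty_ne_coe _)
    · exact (hb n).symm

end Compact

theorem isCompactifiable {T : SpaceTower.{u}} {C : Set TopCat.{u}}
    (hT : ∀ n s, IsMetrizableCompactum (T.space n s)) (hTC : ∀ n s, T.space n s ∈ C)
    (hbC : ∀ b, ∀ hb : T.IsBranch b,
      inverseLimit (fun n => T.space n (b n)) (branchMap hb) ∈ C)
    (hCb : ∀ Y ∈ C, ∃ b, ∃ hb : T.IsBranch b,
      Nonempty (Y ≃ₜ inverseLimit (fun n => T.space n (b n)) (branchMap hb)))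
    {Z : TopCat.{u}} (z₀ : Z) (hZ : IsMetrizableCompactum Z) (hZC : Z ∈ C) :
    IsCompactifiable C := by
  have h1 : ∀ n s, CompactSpace (T.space n s) := fun n s => (hT n s).1
  have h2 : ∀ n s, MetrizableSpace (T.space n s) := fun n s => (hT n s).2
  refine ⟨_, _, T.compactMap Z z₀, T.isMetrizableCompactum_compactTotal Z z₀ hZ,
    T.isMetrizableCompactum_compactBase, ?_, ?_⟩
  · rintro _ ⟨b, rfl⟩
    by_cases hb : ∀ n, b.1 n ≠ OnePoint.infty
    · choose c hc using fun n => OnePoint.ne_infty_iff_exists.1 (hb n)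
      have hc' := isBranch_of_coe fun n => (hc n).symm
      exact ⟨_, hbC c hc', nonempty_homeomorph_branch (fun n => (hc n).symm) hc'⟩
    · push Not at hb
      classical
      -- The first infinite level decides between the fiber `Z` and the space at the last finite
      -- node.
      have hmin := fun m => Nat.find_min hb (m := m)
      have hn := Nat.find_spec hb
      generalize Nat.find hb = n at hn hmin
      cases n with
      | zero => exact ⟨Z, hZC, nonempty_homeomorph_infty hn⟩
      | succ m =>
        obtain ⟨t, ht⟩ := OnePoint.ne_infty_iff_exists.1 (hmin m (Nat.lt_succ_self m))
        exact ⟨_, hTC m t, nonempty_homeomorph_node hZ ht.symm hn⟩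
  · intro Y hY
    obtain ⟨c, hc, ⟨e⟩⟩ := hCb Y hY
    have hc' : IsOnePointThread T.parent fun n => (c n : OnePoint (T.node n)) := by
      intro n y hy
      rw [OnePoint.coe_eq_coe] at hy ⊢
      rw [hc n, hy]
    obtain ⟨e'⟩ := nonempty_homeomorph_branch (Z := Z) (z₀ := z₀)
      (b := ⟨fun n => (c n : OnePoint (T.node n)), hc'⟩) (fun n => rfl) hc
    exact ⟨_, ⟨_, rfl⟩, ⟨e'.trans e.symm⟩⟩

end SpaceTower

/-! ### The tower of composable paths -/

/-- The tower of finite composable paths of maps from the sets `D i j`. -/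
def pathTower (X : ℕ → TopCat.{u}) (D : ∀ i j, Set (X i ⟶ X j))
    (hD : ∀ i j, (D i j).Countable) : SpaceTower.{u} where
  node n := Σ j : Fin (n + 1) → ℕ, ∀ i : Fin n, D (j i.succ) (j i.castSucc)
  countable n := by
    have : ∀ i j, Countable (D i j) := fun i j => (hD i j).to_subtype
    infer_instance
  space n s := X (s.1 (Fin.last n))
  parent n s := ⟨fun i => s.1 i.castSucc, fun i => s.2 i.castSucc⟩
  bond n s := (s.2 (Fin.last n)).1

section PathTower

variable {X : ℕ → TopCat.{u}} {D : ∀ i j, Set (X i ⟶ X j)} {hD : ∀ i j, (D i j).Countable}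

theorem inverseLimit_branchMap_mem_likeSpaces {F : MorphismProperty TopCat.{u}}
    (hF : ∀ i j, ∀ f ∈ D i j, F f) {b : ∀ n, (pathTower X D hD).node n}
    (hb : (pathTower X D hD).IsBranch b) :
    inverseLimit (fun n => (pathTower X D hD).space n (b n)) (SpaceTower.branchMap hb) ∈
      likeSpaces F :=
  ⟨_, _, fun n => SpaceTower.branchMap_mem hb n (hF _ _ _ ((b (n + 1)).2 (Fin.last n)).2),
    ⟨Homeomorph.refl _⟩⟩

theorem exists_branch_inverseLimit_eq (j : ℕ → ℕ) (f : ∀ n, X (j (n + 1)) ⟶ X (j n))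
    (hf : ∀ n, f n ∈ D (j (n + 1)) (j n)) :
    ∃ b, ∃ hb : (pathTower X D hD).IsBranch b,
      inverseLimit (fun n => X (j n)) f =
        inverseLimit (fun n => (pathTower X D hD).space n (b n)) (SpaceTower.branchMap hb) :=
  ⟨fun _ => ⟨fun i => j i, fun i => ⟨f i, hf i⟩⟩, fun _ => rfl, rfl⟩

end PathTower

/-! ### Classes of `F`-like spaces -/

theorem mem_objClass_of_map {F : MorphismProperty TopCat.{u}} {Y Z : TopCat.{u}}
    {f : Y ⟶ Z} (hf : F f) : Y ∈ objClass F ∧ Z ∈ objClass F :=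
  ⟨Or.inl ⟨_, f, hf⟩, Or.inr ⟨_, f, hf⟩⟩

theorem countable_objClass {F : MorphismProperty TopCat.{u}}
    (hF : {f : Arrow TopCat.{u} | F f.hom}.Countable) : (objClass F).Countable := by
  refine ((hF.image fun f => f.left).union (hF.image fun f => f.right)).mono ?_
  rintro X (⟨Y, f, hf⟩ | ⟨Y, f, hf⟩)
  · exact Or.inl ⟨Arrow.mk f, hf, rfl⟩
  · exact Or.inr ⟨Arrow.mk f, hf, rfl⟩

theorem likeSpaces_eq_empty {F : MorphismProperty TopCat.{u}} (h : objClass F = ∅) :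
    likeSpaces F = ∅ := by
  refine Set.eq_empty_of_forall_notMem ?_
  rintro Y ⟨X, f, hf, -⟩
  exact Set.notMem_empty (X 0) (h ▸ (mem_objClass_of_map (hf 0)).2)

theorem exists_eq_comp_of_objClass_eq_range {F : MorphismProperty TopCat.{u}} {X : ℕ → TopCat.{u}}
    (hX : objClass F = Set.range X) {Y : ℕ → TopCat.{u}} {f : ∀ n, Y (n + 1) ⟶ Y n}
    (hf : ∀ n, F (f n)) : ∃ j : ℕ → ℕ, Y = fun n => X (j n) := by
  have h : ∀ n, ∃ i, X i = Y n := fun n => by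
    have := (mem_objClass_of_map (hf n)).2
    rwa [hX] at this
  choose j hj using h
  exact ⟨j, funext fun n => (hj n).symm⟩

theorem isPolishable_likeSpaces {F : MorphismProperty TopCat.{u}}
    (hF : {f : Arrow TopCat.{u} | F f.hom}.Countable) (hP : ∀ X ∈ objClass F, PolishSpace X) :
    IsPolishable (likeSpaces F) := by
  rcases (objClass F).eq_empty_or_nonempty with h | h
  · rw [likeSpaces_eq_empty h]
    refine ⟨TopCat.of PEmpty, TopCat.of PEmpty, 𝟙 _, ?_, ?_, ?_, ?_⟩
    · exact inferInstanceAs (PolishSpace PEmpty)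
    · exact inferInstanceAs (PolishSpace PEmpty)
    · rintro _ ⟨b, -⟩
      exact b.elim
    · rintro _ ⟨⟩
  · obtain ⟨X, hX⟩ := (countable_objClass hF).exists_eq_range h
    let D : ∀ i j, Set (X i ⟶ X j) := fun i j => {f | F f}
    have hD : ∀ i j, (D i j).Countable := fun i j =>
      hF.preimage_of_injOn (f := fun f : X i ⟶ X j => Arrow.mk f)
        (fun f _ g _ hfg => Arrow.mk_injective _ _ hfg)
    refine SpaceTower.isPolishable (T := pathTower X D hD) (fun n s => ?_)
      (fun b hb => inverseLimit_branchMap_mem_likeSpaces (fun _ _ _ hf => hf) hb) ?_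
    · refine hP _ ?_
      rw [hX]
      exact ⟨_, rfl⟩
    · rintro Y ⟨X', f, hf, e⟩
      obtain ⟨j, rfl⟩ := exists_eq_comp_of_objClass_eq_range hX hf
      obtain ⟨b, hb, h⟩ := exists_branch_inverseLimit_eq (D := D) (hD := hD) j f hf
      exact ⟨b, hb, h ▸ e⟩

theorem exists_countable_dense_morphisms (F : MorphismProperty TopCat.{u}) {X Y : TopCat.{u}}
    (hX : IsMetrizableCompactum X) (hY : IsMetrizableCompactum Y) :
    ∃ K : Set C(X, Y), K.Countable ∧ (∀ f ∈ K, F (TopCat.ofHom f)) ∧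
      ∀ f : C(X, Y), F (TopCat.ofHom f) → f ∈ closure K := by
  obtain ⟨_, _⟩ := hX
  obtain ⟨_, _⟩ := hY
  let _ := metrizableSpaceMetric X
  let _ := metrizableSpaceMetric Y
  obtain ⟨K, hKF, hK, hd⟩ := (IsSeparable.of_separableSpace
    {f : C(X, Y) | F (TopCat.ofHom f)}).exists_countable_dense_subset
  exact ⟨K, hK, hKF, hd⟩

theorem isEmpty_inverseLimit {X : ℕ → TopCat.{u}} (f : ∀ n, X (n + 1) ⟶ X n) (h : IsEmpty (X 0)) :
    IsEmpty (inverseLimit X f) :=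
  ⟨fun x => h.elim (x.1 0)⟩

theorem isCompactifiable_likeSpaces {F : MorphismProperty TopCat.{u}}
    (hF : (objClass F).Countable) (hM : ∀ X ∈ objClass F, IsMetrizableCompactum X)
    (hL : ∀ X ∈ objClass F, X ∈ likeSpaces F) : IsCompactifiable (likeSpaces F) := by
  rcases (objClass F).eq_empty_or_nonempty with h | h
  · rw [likeSpaces_eq_empty h]
    refine ⟨TopCat.of PEmpty, TopCat.of PEmpty, 𝟙 _, ⟨?_, ?_⟩, ⟨?_, ?_⟩, ?_, ?_⟩
    · exact inferInstanceAs (CompactSpace PEmpty)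
    · exact inferInstanceAs (MetrizableSpace PEmpty)
    · exact inferInstanceAs (CompactSpace PEmpty)
    · exact inferInstanceAs (MetrizableSpace PEmpty)
    · rintro _ ⟨b, -⟩
      exact b.elim
    · rintro _ ⟨⟩
  by_cases hE : ∃ Z ∈ objClass F, Nonempty Z
  · obtain ⟨Z, hZ, ⟨z₀⟩⟩ := hE
    obtain ⟨X, hX⟩ := hF.exists_eq_range h
    have hXF : ∀ i, X i ∈ objClass F := fun i => hX ▸ ⟨i, rfl⟩
    choose K hK hKF hKd using fun i j =>
      exists_countable_dense_morphisms F (hM _ (hXF i)) (hM _ (hXF j))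
    let D : ∀ i j, Set (X i ⟶ X j) := fun i j => TopCat.ofHom '' K i j
    have hD : ∀ i j, (D i j).Countable := fun i j => (hK i j).image _
    refine SpaceTower.isCompactifiable (T := pathTower X D hD) (fun n s => hM _ (hXF _))
      (fun n s => hL _ (hXF _)) (fun b hb => inverseLimit_branchMap_mem_likeSpaces ?_ hb) ?_
      z₀ (hM Z hZ) (hL Z hZ)
    · rintro i j _ ⟨f, hf, rfl⟩
      exact hKF i j f hf
    · rintro Y ⟨X', f, hf, ⟨e⟩⟩
      obtain ⟨j, rfl⟩ := exists_eq_comp_of_objClass_eq_range hX hf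
      have h1 : ∀ n, CompactSpace (X (j n)) := fun n => (hM _ (hXF _)).1
      have h2 : ∀ n, MetrizableSpace (X (j n)) := fun n => (hM _ (hXF _)).2
      obtain ⟨g, hg, ⟨e'⟩⟩ := exists_mem_homeomorph_threads (X := fun n => X (j n))
        (fun n => (f n).hom) (fun n => K (j (n + 1)) (j n)) fun n => hKd _ _ _ (hf n)
      obtain ⟨b, hb, h⟩ := exists_branch_inverseLimit_eq (D := D) (hD := hD) j
        (fun n => TopCat.ofHom (g n)) fun n => ⟨g n, hg n, rfl⟩
      exact ⟨b, hb, h ▸ ⟨e.trans e'⟩⟩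
  -- No base point `z₀` exists here: the class consists of empty spaces only, and it is realized by
  -- the empty fiber over a one-point base.
  · push Not at hE
    obtain ⟨X, hX⟩ := h
    have hempty : ∀ Y ∈ likeSpaces F, IsEmpty Y := by
      rintro Y ⟨X', f, hf, ⟨e⟩⟩
      have := isEmpty_inverseLimit f (hE _ (mem_objClass_of_map (hf 0)).2)
      exact e.toEquiv.isEmpty
    have hfib : ∀ b : TopCat.of PUnit.{u + 1},
        IsEmpty {a : TopCat.of PEmpty.{u + 1} //
          (TopCat.ofHom ⟨PEmpty.elim, by fun_prop⟩ : TopCat.of PEmpty.{u + 1} ⟶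
            TopCat.of PUnit.{u + 1}) a = b} :=
      fun b => ⟨fun a => a.1.elim⟩
    refine ⟨TopCat.of PEmpty, TopCat.of PUnit, TopCat.ofHom ⟨PEmpty.elim, by fun_prop⟩,
      ⟨?_, ?_⟩, ⟨?_, ?_⟩, ?_, ?_⟩
    · exact inferInstanceAs (CompactSpace PEmpty)
    · exact inferInstanceAs (MetrizableSpace PEmpty)
    · exact inferInstanceAs (CompactSpace PUnit)
    · exact inferInstanceAs (MetrizableSpace PUnit)
    · rintro _ ⟨b, rfl⟩
      have := hE X hX
      have := hfib b
      exact ⟨X, hL X hX, ⟨Homeomorph.empty⟩⟩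
    · intro Y hY
      have := hempty Y hY
      have := hfib PUnit.unit
      exact ⟨_, ⟨PUnit.unit, rfl⟩, ⟨Homeomorph.empty⟩⟩

theorem mem_likeSpaces_of_id {F : MorphismProperty TopCat.{u}} {X : TopCat.{u}} (h : F (𝟙 X)) :
    X ∈ likeSpaces F := by
  refine ⟨fun _ => X, fun _ => 𝟙 X, fun _ => h, ⟨{
    toFun := fun x => ⟨fun _ => x, fun _ => rfl⟩
    invFun := fun x => x.1 0
    left_inv := fun x => rfl
    right_inv := fun x => Subtype.ext (funext fun n => ?_)
    continuous_toFun := Continuous.subtype_mk (continuous_pi fun _ => continuous_id) _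
    continuous_invFun := (continuous_apply 0).comp continuous_subtype_val }⟩⟩
  change x.1 0 = x.1 n
  induction n with
  | zero => rfl
  | succ n ih => exact ih.trans (x.2 n)

theorem surjectionsBetween_id {P : Set TopCat.{u}} {X : TopCat.{u}} (hX : X ∈ P) :
    surjectionsBetween P (𝟙 X) :=
  ⟨hX, hX, fun x => ⟨x, rfl⟩⟩

theorem objClass_surjectionsBetween (P : Set TopCat.{u}) :
    objClass (surjectionsBetween P) = P := by
  ext X
  constructor
  · rintro (⟨Y, f, hf⟩ | ⟨Y, f, hf⟩)
    · exact hf.1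
    · exact hf.2.1
  · exact fun hX => (mem_objClass_of_map (surjectionsBetween_id hX)).1

theorem isCompactifiable_spaceLikeSpaces {P : Set TopCat.{u}} (hP : P.Countable)
    (hM : ∀ X ∈ P, IsMetrizableCompactum X) : IsCompactifiable (spaceLikeSpaces P) := by
  refine isCompactifiable_likeSpaces ?_ ?_ ?_ <;> rw [objClass_surjectionsBetween]
  · exact hP
  · exact hM
  · exact fun X hX => mem_likeSpaces_of_id (surjectionsBetween_id hX)

theorem isMetrizableCompactum_circle :
    IsMetrizableCompactum (TopCat.of (ULift.{u} Circle)) :=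
  ⟨inferInstanceAs (CompactSpace (ULift.{u} Circle)),
    Homeomorph.ulift.isEmbedding.metrizableSpace⟩

theorem mainTheorem11 :
    (∀ F : MorphismProperty TopCat.{u},
      {f : Arrow TopCat.{u} | F f.hom}.Countable →
      (∀ X ∈ objClass F, PolishSpace X) →
      IsPolishable (likeSpaces F)) ∧
    (∀ F : MorphismProperty TopCat.{u},
      (objClass F).Countable →
      (∀ X ∈ objClass F, IsMetrizableCompactum X) →
      (∀ X ∈ objClass F, X ∈ likeSpaces F) →
      IsCompactifiable (likeSpaces F)) ∧
    (∀ (F : MorphismProperty TopCat.{u}) (X : TopCat.{u}), F (𝟙 X) → X ∈ likeSpaces F) ∧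
    (∀ P : Set TopCat.{u},
      P.Countable →
      (∀ X ∈ P, IsMetrizableCompactum X) →
      IsCompactifiable (spaceLikeSpaces P)) ∧
    IsCompactifiable circleLikeSpaces.{u} := by
  refine ⟨fun F => isPolishable_likeSpaces, fun F => isCompactifiable_likeSpaces,
    fun F X => mem_likeSpaces_of_id, fun P => isCompactifiable_spaceLikeSpaces,
    isCompactifiable_spaceLikeSpaces (Set.countable_singleton _) ?_⟩
  rintro _ rfl
  exact isMetrizableCompactum_circle
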